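/- Let $G$ be a compact connected Lie group with a right-invariant smooth Riemannian metric, $|\cdot|_G$ the induced norm on tangent vectors. Let $M$ be a compact Hausdorff space with a Borel probability measure $\mu$, on which $G$ acts continuously, transitively and $\mu$-preservingly. Let $\omega\subset M$ be measurable with $L=\mu(\omega)\in(0,1]$, let $I=[a,b]$ with $a<b$ and $|I|=b-a$, let $\nu\ge 1$, let $E\subset \mathscr C^0(M,\mathbb C)$ be a finite-dimensional complex subspace, and let $\mathcal F\subset\mathscr C^0(I;E^\nu)$ be a finite-dimensional complex subspace; write $|V(t,y)|^2=\sum_{\alpha=1}^\nu|V_\alpha(t,y)|^2$. Let $g_1,\dots,g_J\in G$ and $\theta_1,\dots,\theta_J>0$ with $\sum_j\theta_j=1$ be an exact convexified design, i.e. $$\sum_{j=1}^J\theta_j\int_{g_j\cdot\omega}|f|^2\,d\mu=L\int_M|f|^2\,d\mu\qquad\forall f\in E .$$ Fix a piecewise smooth closed curve in $G$, with nonvanishing velocity on each closed smooth piece (or reduced to a point), which visits $g_1,\dots,g_J$ in that order, and let $D$ be its length (so that $D=\sum_{j=1}^{J-1}d_G(g_j,g_{j+1})+d_G(g_J,g_1)$,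 with $d_G$ the Riemannian distance, if the curve consists of minimizing geodesics between consecutive design points). For $V\in\mathcal F$ put $F_{V,M}(t)=\int_M|V(t,y)|^2d\mu(y)$ and $F_{V,j}(t)=\int_{g_j\cdot\omega}|V(t,y)|^2d\mu(y)$, let $\mathscr S=\{V\in\mathcal F: \int_I F_{V,M}\,dt=1\}$ and $$\varpi_{\mathcal F}(\tau)=\sup_{V\in\mathscr S}\ \sup_{t,s\in I,\ |t-s|\le\tau}\max\Big(|F_{V,M}(t)-F_{V,M}(s)|,\ \max_{1\le j\le J}|F_{V,j}(t)-F_{V,j}(s)|\Big)$$ (with $\varpi_{\mathcal F}=0$ if $\mathcal F=\{0\}$). Then this supremum is finite, and for every $\mathsf V>D/|I|$ and every integer $R\ge1$ with $RD<\mathsf V|I|$ there is a continuous piecewise smooth path $g_{\mathsf V,R}:I\to G$ such that $|\dot g_{\mathsf V,R}(t)|_G\le\mathsf V$ for a.e. $t\in I$ and $$\int_I\int_{g_{\mathsf V,R}(t)\cdot\omega}|V(t,y)|^2\,d\mu(y)\,dt\ \ge\ \big(L-\varepsilon_{\mathcal F}(\mathsf V,R)\big)\int_I\int_M|V(t,y)|^2\,d\mu(y)\,dt\qquad\forall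 V\in\mathcal F,$$ where $$\varepsilon_{\mathcal F}(\mathsf V,R)=L\,\frac{DR}{\mathsf V|I|}+(L+1)\,|I|\,\varpi_{\mathcal F}\Big(\frac{|I|}{R}\Big).$$ Moreover, there are a function $\mathsf V\mapsto\varepsilon_{\mathcal F}(\mathsf V)$ with $\varepsilon_{\mathcal F}(\mathsf V)\to0$ as $\mathsf V\to+\infty$ and, for each $\mathsf V>D/|I|$, an integer $R=R(\mathsf V)\ge1$ with $RD<\mathsf V|I|$, such that the path $g_{\mathsf V,R(\mathsf V)}$ satisfies the same inequality with $\varepsilon_{\mathcal F}(\mathsf V)$ in place of $\varepsilon_{\mathcal F}(\mathsf V,R)$. -/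

import Mathlib

open MeasureTheory Filter Topology Bundle
open scoped Manifold ContDiff Pointwise

namespace MovingObserver

noncomputable section

/-! ### Observations of a profile-valued trajectory -/

section Observation

variable {M : Type*} [TopologicalSpace M] [CompactSpace M] [MeasurableSpace M]
variable {a b : ℝ} {ν : ℕ} {E : Submodule ℂ C(M, ℂ)}

/-- The density `|V(t,y)|²`, the squared Euclidean norm of `V(t,y) ∈ ℂ^ν`. -/
def density (V : C(Set.Icc a b, Fin ν → E)) (t : Set.Icc a b) (y : M) : ℝ :=
  ∑ α : Fin ν, ‖(V t α : C(M, ℂ)) y‖ ^ 2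

/-- The observation at time `t` on the subset `A` of `M`, i.e. `∫_A |V(t,y)|² dμ(y)`. -/
def observation (μ : Measure M) (V : C(Set.Icc a b, Fin ν → E)) (A : Set M)
    (t : Set.Icc a b) : ℝ :=
  ∫ y in A, density V t y ∂μ

/-- The observation on the time interval `I = [a,b]` on the moving subset `t ↦ A t`,
i.e. `∫_I ∫_{A t} |V(t,y)|² dμ(y) dt`. -/
def movingObservation (μ : Measure M) (V : C(Set.Icc a b, Fin ν → E)) (A : ℝ → Set M) : ℝ :=
  ∫ t, observation μ V (A t) t ∂(Measure.comap ((↑) : Set.Icc a b → ℝ) volume)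

/-- The full observation `∫_I ∫_M |V(t,y)|² dμ(y) dt`. -/
def fullObservation (μ : Measure M) (V : C(Set.Icc a b, Fin ν → E)) : ℝ :=
  movingObservation μ V (fun _ => Set.univ)

/-- The set `𝒮` of the elements of `F` whose full observation is equal to `1`. -/
def unitObservationSet (μ : Measure M) (F : Submodule ℂ C(Set.Icc a b, Fin ν → E)) :
    Set C(Set.Icc a b, Fin ν → E) :=
  {V | V ∈ F ∧ fullObservation μ V = 1}

variable {G : Type*} [Group G] [MulAction G M] {J : ℕ}

/-- `(g_j, θ_j)` is an exact convexified design for the profile space `E` and the subset `Ω`. -/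
structure IsExactDesign (μ : Measure M) (Ω : Set M) (E : Submodule ℂ C(M, ℂ))
    (g : Fin J → G) (θ : Fin J → ℝ) : Prop where
  weight_pos : ∀ j, 0 < θ j
  weight_sum : ∑ j, θ j = 1
  exact : ∀ f ∈ E, ∑ j, θ j * ∫ y in g j • Ω, ‖f y‖ ^ 2 ∂μ = μ.real Ω * ∫ y, ‖f y‖ ^ 2 ∂μ

/-- The set of the numbers `max (|F_{V,M}(t) - F_{V,M}(s)|, max_j |F_{V,j}(t) - F_{V,j}(s)|)`, for
`V ∈ 𝒮` and `t, s ∈ I` with `|t - s| ≤ τ`, where `F_{V,M}` and `F_{V,j}` are the observations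
on `M` and on `g_j • Ω`. -/
def oscillationSet (μ : Measure M) (Ω : Set M) (g : Fin J → G)
    (F : Submodule ℂ C(Set.Icc a b, Fin ν → E)) (τ : ℝ) : Set ℝ :=
  {x | ∃ V ∈ unitObservationSet μ F, ∃ t s : Set.Icc a b, |(t : ℝ) - s| ≤ τ ∧
    x = max |observation μ V Set.univ t - observation μ V Set.univ s|
      (⨆ j : Fin J, |observation μ V (g j • Ω) t - observation μ V (g j • Ω) s|)}

/-- The common modulus of continuity `ϖ_F(τ)` of the families `F_{V,M}` and `F_{V,j}`, `V ∈ 𝒮`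
(equal to `0` if `𝒮` is empty, i.e. if `F = 0`). -/
def commonModulus (μ : Measure M) (Ω : Set M) (g : Fin J → G)
    (F : Submodule ℂ C(Set.Icc a b, Fin ν → E)) (τ : ℝ) : ℝ :=
  sSup (oscillationSet μ Ω g F τ)

/-- The error `ε_F(v,R) = L * D R / (v |I|) + (L + 1) |I| ϖ_F(|I| / R)`, where `I = [a,b]`
and `L = μ(Ω)`. -/
def realizationError (μ : Measure M) (Ω : Set M) (g : Fin J → G)
    (F : Submodule ℂ C(Set.Icc a b, Fin ν → E)) (D v : ℝ) (R : ℕ) : ℝ :=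
  μ.real Ω * (D * R / (v * (b - a)))
    + (μ.real Ω + 1) * (b - a) * commonModulus μ Ω g F ((b - a) / R)

end Observation

/-! ### Paths in a Lie group with a right-invariant Riemannian metric -/

section Paths

variable (H : Type*) [NormedAddCommGroup H] [NormedSpace ℝ H]
variable {G : Type*} [TopologicalSpace G] [ChartedSpace H G]

/-- The metric is right-invariant: for every `h`, the differential of the right
translation `x ↦ x * h` is an isometry of each tangent space onto its image. -/
def IsRightInvariantMetric (G : Type*) [TopologicalSpace G] [ChartedSpace H G] [Group G]
    [RiemannianBundle (fun x : G => TangentSpace 𝓘(ℝ, H) x)] : Prop :=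
  ∀ (h x : G) (v : TangentSpace 𝓘(ℝ, H) x),
    ‖mfderiv 𝓘(ℝ, H) 𝓘(ℝ, H) (fun z : G => z * h) x v‖ = ‖v‖

/-- `γ` is continuous and piecewise smooth on `[c,d]`: there is a finite subdivision
`c = t₀ ≤ t₁ ≤ … ≤ t_n = d` such that `γ` is smooth (up to the endpoints) on each
`[t_i, t_{i+1}]`. -/
def IsPiecewiseSmooth (γ : ℝ → G) (c d : ℝ) : Prop :=
  ContinuousOn γ (Set.Icc c d) ∧
  ∃ (n : ℕ) (t : ℕ → ℝ), Monotone t ∧ t 0 = c ∧ t n = d ∧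
    ∀ i < n, ContMDiffOn 𝓘(ℝ, ℝ) 𝓘(ℝ, H) ∞ γ (Set.Icc (t i) (t (i + 1)))

/-- `γ` is continuous and piecewise smooth on `[c,d]`, with nonvanishing velocity (one-sided
at the endpoints) on each of the smooth pieces. -/
def IsPiecewiseRegular (γ : ℝ → G) (c d : ℝ) : Prop :=
  ContinuousOn γ (Set.Icc c d) ∧
  ∃ (n : ℕ) (t : ℕ → ℝ), Monotone t ∧ t 0 = c ∧ t n = d ∧
    ∀ i < n, ContMDiffOn 𝓘(ℝ, ℝ) 𝓘(ℝ, H) ∞ γ (Set.Icc (t i) (t (i + 1))) ∧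
      (t i < t (i + 1) → ∀ s ∈ Set.Icc (t i) (t (i + 1)),
        mfderivWithin 𝓘(ℝ, ℝ) 𝓘(ℝ, H) γ (Set.Icc (t i) (t (i + 1))) s (1 : ℝ) ≠ 0)

/-- `γ : [c,d] → G` is a closed piecewise smooth regular curve (reduced to a point if `c = d`)
which visits the points `g_1, …, g_J` in that order. -/
structure IsCycleThrough {J : ℕ} (γ : ℝ → G) (c d : ℝ) (g : Fin J → G) : Prop where
  le : c ≤ d
  regular : IsPiecewiseRegular H γ c d
  closed : γ c = γ d
  visits : ∃ s : Fin J → ℝ, Monotone s ∧ ∀ j, s j ∈ Set.Icc c d ∧ γ (s j) = g j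

/-- The speed of `γ` is at most `v` at almost every time of `[c,d]`. -/
def SpeedLE [RiemannianBundle (fun x : G => TangentSpace 𝓘(ℝ, H) x)]
    (γ : ℝ → G) (c d v : ℝ) : Prop :=
  ∀ᵐ t ∂(volume.restrict (Set.Icc c d)),
    ‖mfderiv 𝓘(ℝ, ℝ) 𝓘(ℝ, H) γ t (1 : ℝ)‖ ≤ v

end Paths

end

end MovingObserver

/-! ### Arc-length reparametrization on the line. -/

namespace MovingObserver

/-! Cut `I` into `R` periods of length `τ = |I| / R`. In each, run once around the cycle at speed
`v`, which takes time `D / v`, and rest at `g j` for the time `θ j * κ`, where `κ = τ - D / v` is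
positive because `R D < v |I|`. The weights sum to `1`, so a turn lasts exactly `τ`, and it ends
where it began, so turns can be chained.

What is seen while travelling is nonnegative and is discarded. During a period starting at `t_r`,
every observation stays within `η`, the modulus at `τ` times the full observation, of its value at
`t_r`. Resting thus collects at least `κ ∑ θ j (F_j(t_r) - η)`, which by exactness of the design is
`κ (L F_M(t_r) - η)`. Summing over `r` gives a left Riemann sum of `F_M`, which differs from the
integral by at most `|I| η`. The lost fraction of time `D R / (v |I|)` gives the first error term;
the two replacements, of `F_j` with total weight `1` and of `F_M` with weight `L`, give the factor
`L + 1` (`exists_path_realizing`).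

The modulus is finite and tends to `0` by compactness. An invariant probability measure on a compact
space with transitive action charges every nonempty open set, so the full observation is positive
definite on the finite-dimensional `F` and its unit level set lies in the continuous image of a
closed ball (`exists_parametrization`). Uniform continuity on ball × `I` does the rest. Finally `R`
of order `√v` makes both `R / v` and `|I| / R` vanish. -/

/-- The inverse of a primitive of a positive continuous function, as a function on `ℝ`. -/
theorem exists_inverse_primitive {k : ℝ → ℝ} (hk : Continuous k) {m : ℝ} (hm : 0 < m)
    (hmk : ∀ x, m ≤ k x) (u : ℝ) :
    ∃ σ : ℝ → ℝ, StrictMono σ ∧ (∀ x, σ (∫ y in u..x, k y) = x) ∧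
      ∀ x, HasDerivAt σ (k (σ x))⁻¹ x := by
  set l : ℝ → ℝ := fun x => ∫ y in u..x, k y with hl
  have hd : ∀ x, HasDerivAt l (k x) x := fun x =>
    intervalIntegral.integral_hasDerivAt_right (hk.intervalIntegrable _ _)
      hk.aestronglyMeasurable.stronglyMeasurableAtFilter hk.continuousAt
  have hmono : StrictMono l := strictMono_of_deriv_pos fun x => by
    rw [(hd x).deriv]; exact hm.trans_le (hmk x)
  have hcont : Continuous l := continuous_iff_continuousAt.2 fun x => (hd x).continuousAt
  -- The slope is at least `m`, so `l` lies beyond a line of slope `m` at both ends; this makes it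
  -- onto.
  have hmono' : Monotone fun x => l x - m * x := monotone_of_deriv_nonneg
    (fun x => ((hd x).sub ((hasDerivAt_id x).const_mul m)).differentiableAt) fun x => by
      have : HasDerivAt (fun x => l x - m * x) (k x - m * 1) x :=
        (hd x).sub ((hasDerivAt_id x).const_mul m)
      rw [this.deriv]; linarith [hmk x]
  have htop : Tendsto l atTop atTop := by
    refine tendsto_atTop_mono' atTop (f₁ := fun x => m * x + l 0) ?_
      (tendsto_atTop_add_const_right _ _ (tendsto_id.const_mul_atTop hm))
    filter_upwards [eventually_ge_atTop 0] with x hx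
    have := hmono' hx
    simp only at this; linarith
  have hbot : Tendsto l atBot atBot := by
    refine tendsto_atBot_mono' atBot (f₁ := fun x => m * x + l 0) ?_
      (tendsto_atBot_add_const_right _ _ (tendsto_id.const_mul_atBot hm))
    filter_upwards [eventually_le_atBot 0] with x hx
    have := hmono' hx
    simp only at this; linarith
  let e : ℝ ≃o ℝ := hmono.orderIsoOfSurjective l (hcont.surjective htop hbot)
  have he : ∀ x, e x = l x := fun x => rfl
  refine ⟨e.symm, e.symm.strictMono, fun x => ?_, fun x => ?_⟩
  · rw [show ∫ y in u..x, k y = e x from rfl]; exact e.symm_apply_apply x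
  · exact HasDerivAt.of_local_left_inverse e.symm.continuous.continuousAt (hd _)
      (hm.trans_le (hmk _)).ne' (Eventually.of_forall fun y => by
        rw [← he]; exact e.apply_symm_apply y)

/-- The arc-length parameter: if `k` is smooth and positive on `[u,w]`, the primitive of `k`
vanishing at `u` has a smooth inverse. -/
theorem exists_arclength_inverse {k : ℝ → ℝ} {u w : ℝ} (huw : u < w)
    (hk : ContDiffOn ℝ ∞ k (Set.Icc u w)) (hpos : ∀ x ∈ Set.Icc u w, 0 < k x) :
    ∃ σ : ℝ → ℝ, 0 < ∫ y in u..w, k y ∧ σ 0 = u ∧ σ (∫ y in u..w, k y) = w ∧ StrictMono σ ∧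
      ContDiffOn ℝ ∞ σ (Set.Icc 0 (∫ y in u..w, k y)) ∧
      ∀ x ∈ Set.Icc 0 (∫ y in u..w, k y), HasDerivAt σ (k (σ x))⁻¹ x := by
  obtain ⟨x₀, hx₀, hmin⟩ := isCompact_Icc.exists_isMinOn (Set.nonempty_Icc.2 huw.le) hk.continuousOn
  -- Extending `k` by its endpoint values makes the primitive a bijection of `ℝ`, so that `σ` has a
  -- two-sided derivative even at the endpoints.
  set K : ℝ → ℝ := Set.IccExtend huw.le ((Set.Icc u w).domRestrict k) with hK
  have hKc : Continuous K := hk.continuousOn.domRestrict.Icc_extend'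
  have hKk : ∀ x ∈ Set.Icc u w, K x = k x := fun x hx => by
    rw [hK, Set.IccExtend_of_mem _ _ hx]; rfl
  have hKm : ∀ x, k x₀ ≤ K x := fun x => hmin (Subtype.prop _)
  obtain ⟨σ, hmono, hinv, hder⟩ := exists_inverse_primitive hKc (hpos _ hx₀) hKm u
  have hint : ∫ y in u..w, k y = ∫ y in u..w, K y :=
    intervalIntegral.integral_congr fun x hx => (hKk x (by rwa [Set.uIcc_of_le huw.le] at hx)).symm
  have h0 : σ 0 = u := by simpa using hinv u
  have hw : σ (∫ y in u..w, k y) = w := by rw [hint, hinv]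
  set T := ∫ y in u..w, k y with hT
  have hT0 : 0 < T := hmono.lt_iff_lt.1 (by rw [h0, hw]; exact huw)
  have hmaps : Set.MapsTo σ (Set.Icc 0 T) (Set.Icc u w) := fun x hx =>
    ⟨h0 ▸ hmono.monotone hx.1, hw ▸ hmono.monotone hx.2⟩
  have hder' : ∀ x ∈ Set.Icc 0 T, HasDerivAt σ (k (σ x))⁻¹ x := fun x hx => by
    rw [← hKk _ (hmaps hx)]; exact hder x
  refine ⟨σ, hT0, h0, hw, hmono, ?_, hder'⟩
  -- Bootstrap: `σ' = 1 / k(σ)`, so `σ` of class `C^n` implies `σ'` of class `C^n`.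
  rw [contDiffOn_infty]
  intro n
  induction n with
  | zero => exact contDiffOn_zero.2 fun x hx => (hder x).continuousAt.continuousWithinAt
  | succ n ih =>
    rw [Nat.cast_add, Nat.cast_one, contDiffOn_succ_iff_derivWithin (uniqueDiffOn_Icc hT0)]
    refine ⟨fun x hx => (hder x).differentiableAt.differentiableWithinAt, by simp, ?_⟩
    have : ContDiffOn ℝ n (fun x => (k (σ x))⁻¹) (Set.Icc 0 T) :=
      ((hk.of_le (by exact_mod_cast le_top)).comp ih hmaps).inv fun x hx => (hpos _ (hmaps hx)).ne'
    exact this.congr fun x hx =>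
      (hder' x hx).hasDerivWithinAt.derivWithin (uniqueDiffOn_Icc hT0 x hx)

/-! ### Constant-speed travel along a regular piece; concatenation of paths. -/

section Travel

variable {H : Type*} [NormedAddCommGroup H] [NormedSpace ℝ H]
  {G : Type*} [TopologicalSpace G] [ChartedSpace H G]

/-- The velocity is the tangent map applied to the unit field, hence smooth into the tangent bundle.
Its norm is the square root of a smooth function, and regularity keeps that function away from `0`.
-/
theorem contDiffOn_norm_mfderivWithin [IsManifold 𝓘(ℝ, H) ∞ G]
    [RiemannianBundle (fun x : G => TangentSpace 𝓘(ℝ, H) x)]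
    [IsContMDiffRiemannianBundle 𝓘(ℝ, H) ∞ H (fun x : G => TangentSpace 𝓘(ℝ, H) x)]
    {γ : ℝ → G} {u w : ℝ} (huw : u < w)
    (hγ : ContMDiffOn 𝓘(ℝ, ℝ) 𝓘(ℝ, H) ∞ γ (Set.Icc u w))
    (hne : ∀ s ∈ Set.Icc u w,
      mfderivWithin 𝓘(ℝ, ℝ) 𝓘(ℝ, H) γ (Set.Icc u w) s (1 : ℝ) ≠ 0) :
    ContDiffOn ℝ ∞
      (fun s => ‖mfderivWithin 𝓘(ℝ, ℝ) 𝓘(ℝ, H) γ (Set.Icc u w) s (1 : ℝ)‖) (Set.Icc u w) := by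
  have hU : UniqueMDiffOn 𝓘(ℝ, ℝ) (Set.Icc u w) := (uniqueDiffOn_Icc huw).uniqueMDiffOn
  have h1 := hγ.contMDiffOn_tangentMapWithin (m := ∞) (by simp) hU
  have h2 : ContMDiff 𝓘(ℝ, ℝ) 𝓘(ℝ, ℝ).tangent ∞
      (fun s : ℝ => (⟨s, (1 : ℝ)⟩ : TangentBundle 𝓘(ℝ, ℝ) ℝ)) := by
    rw [← contMDiffOn_univ]
    exact contMDiffOn_vectorSpace_iff_contDiffOn.2 contDiffOn_const
  have h3 : ContMDiffOn 𝓘(ℝ, ℝ) 𝓘(ℝ, H).tangent ∞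
      (fun s : ℝ => (⟨γ s, mfderivWithin 𝓘(ℝ, ℝ) 𝓘(ℝ, H) γ (Set.Icc u w) s (1 : ℝ)⟩ :
        TangentBundle 𝓘(ℝ, H) G)) (Set.Icc u w) :=
    h1.comp h2.contMDiffOn fun s hs => hs
  have h4 := ContMDiffOn.inner_bundle (F := H) (E := fun x : G => TangentSpace 𝓘(ℝ, H) x)
    (b := γ) h3 h3
  rw [contMDiffOn_iff_contDiffOn] at h4
  simp_rw [norm_eq_sqrt_real_inner]
  exact h4.sqrt fun s hs => by
    rw [real_inner_self_eq_norm_sq]; exact pow_ne_zero _ (norm_ne_zero_iff.2 (hne s hs))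

theorem pathELength_eq_ofReal_integral
    [RiemannianBundle (fun x : G => TangentSpace 𝓘(ℝ, H) x)]
    {γ : ℝ → G} {u w : ℝ} (huw : u ≤ w)
    (hc : ContinuousOn (fun s => ‖mfderivWithin 𝓘(ℝ, ℝ) 𝓘(ℝ, H) γ (Set.Icc u w) s (1 : ℝ)‖)
      (Set.Icc u w)) :
    Manifold.pathELength 𝓘(ℝ, H) γ u w = ENNReal.ofReal
      (∫ s in u..w, ‖mfderivWithin 𝓘(ℝ, ℝ) 𝓘(ℝ, H) γ (Set.Icc u w) s (1 : ℝ)‖) := by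
  rw [Manifold.pathELength_eq_lintegral_mfderivWithin_Icc,
    intervalIntegral.integral_of_le huw, ← integral_Icc_eq_integral_Ioc,
    ofReal_integral_eq_lintegral_ofReal (hc.integrableOn_Icc)
      (Eventually.of_forall fun _ => norm_nonneg _)]
  refine lintegral_congr fun s => ?_
  exact (ofReal_norm _).symm

variable (H) in
theorem ContMDiffOn.isPiecewiseSmooth {f : ℝ → G} {p q : ℝ} (hpq : p ≤ q)
    (hf : ContMDiffOn 𝓘(ℝ, ℝ) 𝓘(ℝ, H) ∞ f (Set.Icc p q)) : IsPiecewiseSmooth H f p q := by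
  refine ⟨hf.continuousOn, 1, fun i => if i = 0 then p else q, ?_, by simp, by simp, ?_⟩
  · intro i j hij
    by_cases hi : i = 0 <;> by_cases hj : j = 0 <;> simp [hi, hj, hpq]
    omega
  · intro i hi
    obtain rfl : i = 0 := by omega
    simpa using hf

theorem IsPiecewiseSmooth.congr {f h : ℝ → G} {p q : ℝ} (hf : IsPiecewiseSmooth H f p q)
    (hfh : Set.EqOn h f (Set.Icc p q)) : IsPiecewiseSmooth H h p q := by
  obtain ⟨hc, n, t, hm, h0, hn, ht⟩ := hf
  refine ⟨hc.congr hfh, n, t, hm, h0, hn, fun i hi => (ht i hi).congr fun x hx => hfh ⟨?_, ?_⟩⟩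
  · rw [← h0]; exact (hm (Nat.zero_le i)).trans hx.1
  · rw [← hn]; exact hx.2.trans (hm hi)

theorem IsPiecewiseSmooth.append {f : ℝ → G} {p q r : ℝ} (hpq : p ≤ q) (hqr : q ≤ r)
    (h₁ : IsPiecewiseSmooth H f p q)
    (h₂ : IsPiecewiseSmooth H f q r) : IsPiecewiseSmooth H f p r := by
  obtain ⟨hc, n, t, hm, h0, hn, ht⟩ := h₁
  obtain ⟨hc', n', t', hm', h0', hn', ht'⟩ := h₂
  refine ⟨?_, n + n', fun i => if i ≤ n then t i else t' (i - n), ?_, by simpa using h0, ?_, ?_⟩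
  · rw [← Set.Icc_union_Icc_eq_Icc hpq hqr]
    exact hc.union_of_isClosed hc' isClosed_Icc isClosed_Icc
  · intro i j hij
    by_cases hi : i ≤ n <;> by_cases hj : j ≤ n <;> simp only [hi, hj, if_true, if_false]
    · exact hm hij
    · exact (hm hi).trans (by rw [hn, ← h0']; exact hm' (Nat.zero_le _))
    · omega
    · exact hm' (by omega)
  · by_cases hn0 : n' = 0
    · subst hn0; simp [hn, ← hn', h0']
    · simp [hn0, hn']
  · intro i hi
    by_cases hin : i + 1 ≤ n
    · simpa [hin, (Nat.le_succ i).trans hin] using ht i hin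
    · have := ht' (i - n) (by omega)
      rw [show i - n + 1 = i + 1 - n by omega] at this
      by_cases hin' : i ≤ n
      · obtain rfl : i = n := by omega
        simpa [hn, h0'] using this
      · simpa [hin, hin'] using this

variable [RiemannianBundle (fun x : G => TangentSpace 𝓘(ℝ, H) x)]

/-- The two-sided derivative at an endpoint depends on values outside the interval. Removing the
endpoints, a null set, lets the speed bound be checked from the values on `[p,q]` alone. -/
theorem speedLE_iff_Ioo {f : ℝ → G} {p q v : ℝ} : SpeedLE H f p q v ↔
    ∀ᵐ t ∂(volume.restrict (Set.Ioo p q)),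
      ‖mfderiv 𝓘(ℝ, ℝ) 𝓘(ℝ, H) f t (1 : ℝ)‖ ≤ v := by
  rw [SpeedLE, restrict_Ioo_eq_restrict_Icc]

theorem SpeedLE.of_forall {f : ℝ → G} {p q v : ℝ}
    (h : ∀ t ∈ Set.Ioo p q, ‖mfderiv 𝓘(ℝ, ℝ) 𝓘(ℝ, H) f t (1 : ℝ)‖ ≤ v) : SpeedLE H f p q v :=
  speedLE_iff_Ioo.2 ((ae_restrict_iff' measurableSet_Ioo).2 (Eventually.of_forall h))

theorem SpeedLE.congr {f h : ℝ → G} {p q v : ℝ} (hf : SpeedLE H f p q v)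
    (hfh : Set.EqOn h f (Set.Icc p q)) : SpeedLE H h p q v := by
  rw [speedLE_iff_Ioo, ae_restrict_iff' measurableSet_Ioo] at *
  filter_upwards [hf] with t ht hts
  have e : h =ᶠ[𝓝 t] f := by
    filter_upwards [Ioo_mem_nhds hts.1 hts.2] with x hx using hfh ⟨hx.1.le, hx.2.le⟩
  have e1 : mfderiv 𝓘(ℝ, ℝ) 𝓘(ℝ, H) h t = mfderiv 𝓘(ℝ, ℝ) 𝓘(ℝ, H) f t := e.mfderiv_eq
  have e2 : h t = f t := e.eq_of_nhds
  -- The norm depends on the base point, and `h t = f t` is only a propositional equality, so the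
  -- norm must be transported.
  have key : ∀ (x y : G) (_ : x = y) (z : H), ‖(id z : TangentSpace 𝓘(ℝ, H) x)‖ =
      ‖(id z : TangentSpace 𝓘(ℝ, H) y)‖ := by
    rintro x _ rfl z; rfl
  refine le_of_eq_of_le ?_ (ht hts)
  rw [e1]
  exact key _ _ e2 (mfderiv 𝓘(ℝ, ℝ) 𝓘(ℝ, H) f t (1 : ℝ))

theorem SpeedLE.append {f : ℝ → G} {p q r v : ℝ} (hpq : p ≤ q) (hqr : q ≤ r)
    (h₁ : SpeedLE H f p q v) (h₂ : SpeedLE H f q r v) : SpeedLE H f p r v := by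
  rw [SpeedLE, ← Set.Icc_union_Icc_eq_Icc hpq hqr, ae_restrict_union_iff]
  exact ⟨h₁, h₂⟩

/-- A smooth regular piece of length `ℓ` is travelled at speed `v` in the time `ℓ / v`. -/
theorem exists_constant_speed_param [IsManifold 𝓘(ℝ, H) ∞ G]
    [IsContMDiffRiemannianBundle 𝓘(ℝ, H) ∞ H (fun x : G => TangentSpace 𝓘(ℝ, H) x)]
    {γ : ℝ → G} {u w v : ℝ} (huw : u < w) (hv : 0 < v)
    (hγ : ContMDiffOn 𝓘(ℝ, ℝ) 𝓘(ℝ, H) ∞ γ (Set.Icc u w))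
    (hne : ∀ s ∈ Set.Icc u w,
      mfderivWithin 𝓘(ℝ, ℝ) 𝓘(ℝ, H) γ (Set.Icc u w) s (1 : ℝ) ≠ 0) (p : ℝ) :
    ∃ f : ℝ → G,
      IsPiecewiseSmooth H f p (p + (Manifold.pathELength 𝓘(ℝ, H) γ u w).toReal / v) ∧
      SpeedLE H f p (p + (Manifold.pathELength 𝓘(ℝ, H) γ u w).toReal / v) v ∧
      f p = γ u ∧ f (p + (Manifold.pathELength 𝓘(ℝ, H) γ u w).toReal / v) = γ w := by
  have hk := contDiffOn_norm_mfderivWithin huw hγ hne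
  obtain ⟨σ, hT, h0, hw, hmono, hσ, hder⟩ :=
    exists_arclength_inverse huw hk fun s hs => norm_pos_iff.2 (hne s hs)
  rw [pathELength_eq_ofReal_integral huw.le hk.continuousOn, ENNReal.toReal_ofReal hT.le]
  set T := ∫ s in u..w, ‖mfderivWithin 𝓘(ℝ, ℝ) 𝓘(ℝ, H) γ (Set.Icc u w) s (1 : ℝ)‖ with hTdef
  have hT' : v * (p + T / v - p) = T := by field_simp; ring
  have hmaps : ∀ t ∈ Set.Icc p (p + T / v), v * (t - p) ∈ Set.Icc 0 T := fun t ht =>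
    ⟨mul_nonneg hv.le (by linarith [ht.1]), by
      rw [← hT']; exact mul_le_mul_of_nonneg_left (by linarith [ht.2]) hv.le⟩
  refine ⟨fun t => γ (σ (v * (t - p))), ?_, ?_, by simp [h0], by simp only [hT', hw]⟩
  · refine ContMDiffOn.isPiecewiseSmooth H (by have := div_pos hT hv; linarith) ?_
    have h1 : ContDiffOn ℝ ∞ (fun t => σ (v * (t - p))) (Set.Icc p (p + T / v)) :=
      hσ.comp (by fun_prop) hmaps
    refine hγ.comp h1.contMDiffOn fun t ht => ⟨?_, ?_⟩
    · rw [← h0]; exact hmono.monotone (hmaps t ht).1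
    · rw [← hw]; exact hmono.monotone (hmaps t ht).2
  · refine SpeedLE.of_forall fun t ht => ?_
    set x := v * (t - p) with hx
    have hx0 : 0 < x := mul_pos hv (by linarith [ht.1])
    have hxT : x < T := by
      rw [← hT']; exact mul_lt_mul_of_pos_left (by linarith [ht.2]) hv
    have hmem : σ x ∈ Set.Ioo u w := ⟨h0 ▸ hmono hx0, hw ▸ hmono hxT⟩
    have hnhds : Set.Icc u w ∈ 𝓝 (σ x) := Icc_mem_nhds hmem.1 hmem.2
    have hγd : HasMFDerivAt 𝓘(ℝ, ℝ) 𝓘(ℝ, H) γ (σ x) (mfderiv 𝓘(ℝ, ℝ) 𝓘(ℝ, H) γ (σ x)) :=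
      ((hγ.mdifferentiableOn (by simp) (σ x) ⟨hmem.1.le, hmem.2.le⟩).mdifferentiableAt
        hnhds).hasMFDerivAt
    have hin : HasDerivAt (fun t => v * (t - p)) v t := by
      simpa using ((hasDerivAt_id t).sub_const p).const_mul v
    -- The parameter moves at rate `v / k(σ x)`, where `k` is the speed of `γ`; the factor `k`
    -- cancels in the norm.
    have hσd : HasDerivAt (fun t => σ (v * (t - p))) _ t :=
      (hder x ⟨hx0.le, hxT.le⟩).comp t hin
    have hk0 := norm_pos_iff.2 (hne (σ x) ⟨hmem.1.le, hmem.2.le⟩)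
    rw [mfderivWithin_of_mem_nhds hnhds] at hk0 hσd
    change ‖(mfderiv 𝓘(ℝ, ℝ) 𝓘(ℝ, H) (γ ∘ fun t => σ (v * (t - p))) t) (1 : ℝ)‖ ≤ v
    rw [(hγd.comp t hσd.hasFDerivAt.hasMFDerivAt).mfderiv]
    have e : ∀ (A : TangentSpace 𝓘(ℝ, ℝ) (σ x) →L[ℝ] TangentSpace 𝓘(ℝ, H) (γ (σ x))) (r : ℝ),
        (A ∘SL ContinuousLinearMap.toSpanSingleton ℝ r) (1 : ℝ) = r • A (1 : ℝ) := fun A r =>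
      (congrArg A (mul_comm (1 : ℝ) r)).trans (A.map_smul r (1 : ℝ))
    refine le_of_eq ((congrArg norm (e _ _)).trans ?_)
    rw [norm_smul, Real.norm_eq_abs, abs_of_pos (by positivity)]
    field_simp

end Travel

/-! ### Tours: chaining travel and rest, then repeating a closed turn. -/

section Tours

variable {H : Type*} [NormedAddCommGroup H] [NormedSpace ℝ H]
  {G : Type*} [TopologicalSpace G] [ChartedSpace H G]
  [RiemannianBundle (fun x : G => TangentSpace 𝓘(ℝ, H) x)]
  {ι : Type*} [Fintype ι] {v : ℝ} {g : ι → G}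

theorem exists_glue {X : Type*} {f₁ f₂ : ℝ → X} {q : ℝ} (h : f₁ q = f₂ q) :
    ∃ f : ℝ → X, (∀ p, Set.EqOn f f₁ (Set.Icc p q)) ∧ ∀ r, Set.EqOn f f₂ (Set.Icc q r) := by
  classical
  refine ⟨fun t => if t ≤ q then f₁ t else f₂ t, fun p t ht => if_pos ht.2, fun r t ht => ?_⟩
  rcases ht.1.eq_or_lt with rfl | hlt
  · simpa using h
  · exact if_neg hlt.not_ge

theorem setLIntegral_Ioc_congr_of_eqOn {X : Type*} {f h : ℝ → X} {p q : ℝ}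
    (hfh : Set.EqOn h f (Set.Icc p q)) (Ψ : ℝ → X → ENNReal) :
    ∫⁻ t in Set.Ioc p q, Ψ t (h t) = ∫⁻ t in Set.Ioc p q, Ψ t (f t) :=
  setLIntegral_congr_fun measurableSet_Ioc fun t ht => by
    simp only [hfh (Set.Ioc_subset_Icc_self ht)]

theorem setLIntegral_Ioc_add {p q r : ℝ} (hpq : p ≤ q) (hqr : q ≤ r) (φ : ℝ → ENNReal) :
    (∫⁻ t in Set.Ioc p q, φ t) + ∫⁻ t in Set.Ioc q r, φ t = ∫⁻ t in Set.Ioc p r, φ t := by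
  rw [← Set.Ioc_union_Ioc_eq_Ioc hpq hqr, lintegral_union measurableSet_Ioc]
  exact Set.disjoint_left.2 fun t ht ht' => ht'.1.not_ge ht.2

variable (H v g) in
/-- For every starting time there is a piecewise smooth path of speed at most `v` from `x` to `y`,
of duration `T`, which dwells at each point `g i` for a total time `δ i`, over disjoint sets of
times. The dwelling is expressed by the lower bounds it gives for time integrals along the path. -/
def Tour (T : ℝ) (δ : ι → ℝ) (x y : G) : Prop :=
  ∀ p : ℝ, ∃ f : ℝ → G, IsPiecewiseSmooth H f p (p + T) ∧ SpeedLE H f p (p + T) v ∧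
    f p = x ∧ f (p + T) = y ∧
    ∀ (Ψ : ℝ → G → ENNReal) (m : ι → ENNReal),
      (∀ i, ∀ t ∈ Set.Icc p (p + T), m i ≤ Ψ t (g i)) →
        ∑ i, ENNReal.ofReal (δ i) * m i ≤ ∫⁻ t in Set.Ioc p (p + T), Ψ t (f t)

/-- Dwelling is encoded by lower integrals of arbitrary integrands, so it adds over adjacent
intervals without any measurability of `Ψ`. -/
theorem Tour.trans {T T' : ℝ} {δ δ' : ι → ℝ} {x y z : G} (hT : 0 ≤ T) (hT' : 0 ≤ T')
    (h : Tour H v g T δ x y) (h' : Tour H v g T' δ' y z) :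
    Tour H v g (T + T') (δ + δ') x z := by
  intro p
  obtain ⟨f₁, hs, hv, hx, hy, hΨ⟩ := h p
  obtain ⟨f₂, hs', hv', hy', hz, hΨ'⟩ := h' (p + T)
  obtain ⟨f, hf, hf'⟩ := exists_glue (hy.trans hy'.symm)
  rw [add_assoc] at hs' hv' hz hΨ'
  have h1 : p ≤ p + T := by linarith
  have h2 : p + T ≤ p + (T + T') := by linarith
  refine ⟨f, (hs.congr (hf p)).append h1 h2 (hs'.congr (hf' _)),
    (hv.congr (hf p)).append h1 h2 (hv'.congr (hf' _)), by rw [hf p ⟨le_rfl, h1⟩, hx],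
    by rw [hf' _ ⟨h2, le_rfl⟩, hz], fun Ψ m hm => ?_⟩
  rw [← setLIntegral_Ioc_add h1 h2, setLIntegral_Ioc_congr_of_eqOn (hf p) Ψ,
    setLIntegral_Ioc_congr_of_eqOn (hf' _) Ψ]
  refine le_trans ?_ (add_le_add (hΨ Ψ m fun i t ht => hm i t ⟨ht.1, ht.2.trans h2⟩)
    (hΨ' Ψ m fun i t ht => hm i t ⟨h1.trans ht.1, ht.2⟩))
  rw [← Finset.sum_add_distrib]
  refine Finset.sum_le_sum fun i _ => ?_
  rw [← add_mul]
  exact mul_le_mul_left (ENNReal.ofReal_add_le) _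

theorem Tour.rest [DecidableEq ι] (hv : 0 ≤ v) (i : ι) {r : ℝ} (hr : 0 ≤ r) :
    Tour H v g r (Pi.single i r) (g i) (g i) := by
  intro p
  refine ⟨fun _ => g i, ContMDiffOn.isPiecewiseSmooth H (by linarith) contMDiffOn_const,
    SpeedLE.of_forall fun t ht => ?_, rfl, rfl, fun Ψ m hm => ?_⟩
  · rw [mfderiv_const]
    exact (norm_zero (E := TangentSpace 𝓘(ℝ, H) (g i))).trans_le hv
  · rw [Finset.sum_eq_single i (fun j _ hj => by simp [hj]) (by simp), Pi.single_eq_same]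
    calc ENNReal.ofReal r * m i = ∫⁻ t in Set.Ioc p (p + r), m i := by
          rw [setLIntegral_const, Real.volume_Ioc, add_sub_cancel_left, mul_comm]
      _ ≤ _ := setLIntegral_mono' measurableSet_Ioc fun t ht => hm i t (Set.Ioc_subset_Icc_self ht)

theorem Tour.refl (hv : 0 ≤ v) (x : G) : Tour H v g 0 0 x x := by
  intro p
  refine ⟨fun _ => x, ContMDiffOn.isPiecewiseSmooth H (by linarith) contMDiffOn_const,
    SpeedLE.of_forall fun t ht => ?_, rfl, rfl, fun Ψ m hm => by simp⟩
  rw [mfderiv_const]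
  exact (norm_zero (E := TangentSpace 𝓘(ℝ, H) x)).trans_le hv

theorem toReal_pathELength_add {γ : ℝ → G} {c d u w z : ℝ}
    (hfin : Manifold.pathELength 𝓘(ℝ, H) γ c d ≠ ⊤) (hu : c ≤ u) (huw : u ≤ w) (hwz : w ≤ z)
    (hz : z ≤ d) :
    (Manifold.pathELength 𝓘(ℝ, H) γ u w).toReal + (Manifold.pathELength 𝓘(ℝ, H) γ w z).toReal =
      (Manifold.pathELength 𝓘(ℝ, H) γ u z).toReal := by
  rw [← Manifold.pathELength_add huw hwz, ENNReal.toReal_add]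
  · exact ne_top_of_le_ne_top hfin (Manifold.pathELength_mono hu (hwz.trans hz))
  · exact ne_top_of_le_ne_top hfin (Manifold.pathELength_mono (hu.trans huw) hz)

/-- Repetition of a closed tour. -/
theorem Tour.exists_repeat {T : ℝ} {δ : ι → ℝ} {x : G} (hv : 0 ≤ v) (hT : 0 ≤ T)
    (h : Tour H v g T δ x x) (a : ℝ) (R : ℕ) :
    ∃ f : ℝ → G, IsPiecewiseSmooth H f a (a + R * T) ∧ SpeedLE H f a (a + R * T) v ∧
      f (a + R * T) = x ∧
      ∀ (Ψ : ℝ → G → ENNReal) (m : ℕ → ι → ENNReal),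
        (∀ r < R, ∀ i, ∀ t ∈ Set.Icc (a + r * T) (a + (r + 1) * T), m r i ≤ Ψ t (g i)) →
          ∑ r ∈ Finset.range R, ∑ i, ENNReal.ofReal (δ i) * m r i ≤
            ∫⁻ t in Set.Ioc a (a + R * T), Ψ t (f t) := by
  induction R with
  | zero =>
    obtain ⟨f, h1, h2, h3, h4, -⟩ := Tour.refl (H := H) (g := g) hv x a
    exact ⟨f, by simpa using h1, by simpa using h2, by simpa using h3, fun Ψ m _ => by simp⟩
  | succ R ih =>
    obtain ⟨f₁, hs, hv, hx, hΨ⟩ := ih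
    obtain ⟨f₂, hs', hv', hy', hz, hΨ'⟩ := h (a + R * T)
    obtain ⟨f, hf, hf'⟩ := exists_glue (hx.trans hy'.symm)
    have e : a + R * T + T = a + ((R + 1 : ℕ) : ℝ) * T := by push_cast; ring
    rw [e] at hs' hv' hz hΨ'
    have h1 : a ≤ a + R * T := by have : 0 ≤ R * T := by positivity
                                  linarith
    have h2 : a + R * T ≤ a + ((R + 1 : ℕ) : ℝ) * T := by linarith
    refine ⟨f, (hs.congr (hf a)).append h1 h2 (hs'.congr (hf' _)),
      (hv.congr (hf a)).append h1 h2 (hv'.congr (hf' _)), by rw [hf' _ ⟨h2, le_rfl⟩, hz],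
      fun Ψ m hm => ?_⟩
    rw [← setLIntegral_Ioc_add h1 h2, setLIntegral_Ioc_congr_of_eqOn (hf a) Ψ,
      setLIntegral_Ioc_congr_of_eqOn (hf' _) Ψ, Finset.sum_range_succ]
    exact add_le_add (hΨ Ψ m fun r hr i t ht => hm r (by omega) i t ht)
      (hΨ' Ψ (m R) fun i t ht => hm R (by omega) i t (by simpa using ht))

variable [IsManifold 𝓘(ℝ, H) ∞ G]
  [IsContMDiffRiemannianBundle 𝓘(ℝ, H) ∞ H (fun x : G => TangentSpace 𝓘(ℝ, H) x)]

/-- A design point may be visited in the interior of a smooth piece, so subintervals of a piece must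
be travelled too; the derivative within the subinterval is the same. -/
theorem Tour.travel_piece (hv : 0 < v) {γ : ℝ → G} {p q u w : ℝ}
    (hγ : ContMDiffOn 𝓘(ℝ, ℝ) 𝓘(ℝ, H) ∞ γ (Set.Icc p q))
    (hne : p < q → ∀ s ∈ Set.Icc p q,
      mfderivWithin 𝓘(ℝ, ℝ) 𝓘(ℝ, H) γ (Set.Icc p q) s (1 : ℝ) ≠ 0)
    (hu : p ≤ u) (huw : u ≤ w) (hw : w ≤ q) :
    Tour H v g ((Manifold.pathELength 𝓘(ℝ, H) γ u w).toReal / v) 0 (γ u) (γ w) := by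
  rcases huw.eq_or_lt with rfl | huw
  · simpa using Tour.refl hv.le (γ u)
  have hsub : Set.Icc u w ⊆ Set.Icc p q := Set.Icc_subset_Icc hu hw
  have hne' : ∀ s ∈ Set.Icc u w,
      mfderivWithin 𝓘(ℝ, ℝ) 𝓘(ℝ, H) γ (Set.Icc u w) s (1 : ℝ) ≠ 0 := fun s hs => by
    rw [mfderivWithin_subset hsub ((uniqueDiffOn_Icc huw).uniqueMDiffOn s hs)
      (hγ.mdifferentiableOn (by simp) s (hsub hs))]
    exact hne (by linarith) s (hsub hs)
  intro p
  obtain ⟨f, h1, h2, h3, h4⟩ := exists_constant_speed_param huw hv (hγ.mono hsub) hne' p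
  exact ⟨f, h1, h2, h3, h4, fun Ψ m _ => by simp⟩

/-- Induction on the number of pieces lying before `w`, cutting at the last break point between `u`
and `w`. -/
theorem Tour.travel (hv : 0 < v) {γ : ℝ → G} {c d : ℝ} (hγ : IsPiecewiseRegular H γ c d)
    (hfin : Manifold.pathELength 𝓘(ℝ, H) γ c d ≠ ⊤) {u w : ℝ}
    (hu : c ≤ u) (huw : u ≤ w) (hw : w ≤ d) :
    Tour H v g ((Manifold.pathELength 𝓘(ℝ, H) γ u w).toReal / v) 0 (γ u) (γ w) := by
  obtain ⟨-, n, t, hm, h0, hn, ht⟩ := hγ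
  have key : ∀ j ≤ n, ∀ u w, c ≤ u → u ≤ w → w ≤ t j →
      Tour H v g ((Manifold.pathELength 𝓘(ℝ, H) γ u w).toReal / v) 0 (γ u) (γ w) := by
    intro j
    induction j with
    | zero =>
      intro _ u w hu huw hw
      obtain rfl : u = w := by rw [h0] at hw; linarith
      simpa using Tour.refl hv.le (γ u)
    | succ j ih =>
      intro hj u w hu huw hw
      have hjn : t (j + 1) ≤ d := hn ▸ hm hj
      obtain ⟨hs, hne⟩ := ht j hj
      rcases le_total w (t j) with hwj | hwj
      · exact ih (by omega) u w hu huw hwj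
      rcases le_total u (t j) with huj | huj
      · have := (ih (by omega) u (t j) hu huj le_rfl).trans (by positivity) (by positivity)
          (Tour.travel_piece hv hs hne le_rfl hwj hw)
        rwa [← add_div, toReal_pathELength_add hfin hu huj hwj (hw.trans hjn), add_zero] at this
      · exact Tour.travel_piece hv hs hne huj huw hw
  exact key n le_rfl u w hu huw (hn ▸ hw)

/-- One turn around the cycle, with prescribed dwelling times at the design points. -/
theorem Tour.cycle {J : ℕ} {g : Fin J → G} (hv : 0 < v) {γ : ℝ → G} {c d : ℝ}
    (hγ : IsCycleThrough H γ c d g) (hfin : Manifold.pathELength 𝓘(ℝ, H) γ c d ≠ ⊤)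
    {δ : Fin J → ℝ} (hδ : ∀ i, 0 ≤ δ i) :
    Tour H v g ((Manifold.pathELength 𝓘(ℝ, H) γ c d).toReal / v + ∑ i, δ i) δ (γ c) (γ c) := by
  obtain ⟨hcd, hreg, hclosed, s, hsm, hs⟩ := hγ
  -- Invariant: the first `k` rests are done and the tour stands at a parameter `x` that precedes
  -- all remaining visits. After the last rest it runs on to `d`, where `γ d = γ c`.
  have key : ∀ k ≤ J, ∃ x ∈ Set.Icc c d, (∀ i : Fin J, k ≤ i.val → x ≤ s i) ∧
      Tour H v g ((Manifold.pathELength 𝓘(ℝ, H) γ c x).toReal / v +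
        ∑ i : Fin J, if i.val < k then δ i else 0) (fun i => if i.val < k then δ i else 0)
        (γ c) (γ x) := by
    intro k
    induction k with
    | zero =>
      intro _
      refine ⟨c, ⟨le_rfl, hcd⟩, fun i _ => (hs i).1.1, ?_⟩
      simpa using! Tour.refl hv.le (γ c)
    | succ k ih =>
      intro hk
      obtain ⟨x, hx, hxs, htour⟩ := ih (by omega)
      have hpos : 0 ≤ ∑ i : Fin J, if i.val < k then δ i else 0 :=
        Finset.sum_nonneg fun i _ => by split_ifs; exacts [hδ i, le_rfl]
      set j : Fin J := ⟨k, hk⟩ with hj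
      refine ⟨s j, (hs j).1, fun i hi => hsm (Fin.le_def.2 (by simp only [hj]; omega)), ?_⟩
      have h1 := (htour.trans (by positivity) (by positivity)
        (Tour.travel hv hreg hfin hx.1 (hxs j le_rfl) (hs j).1.2))
      rw [(hs j).2] at h1 ⊢
      have h2 := h1.trans (by positivity) (hδ j) (Tour.rest hv.le j (hδ j))
      have e : (fun i : Fin J => if i.val < k then δ i else 0) + 0 + Pi.single j (δ j) =
          fun i : Fin J => if i.val < k + 1 then δ i else 0 := by
        ext i
        rcases eq_or_ne i j with rfl | hij
        · simp [hj]
        · have : i.val ≠ k := fun h => hij (Fin.ext h)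
          have h' : i.val < k + 1 ↔ i.val < k := by omega
          simp [hij, h']
      rw [e] at h2
      convert h2 using 1
      rw [← e, ← toReal_pathELength_add hfin le_rfl hx.1 (hxs j le_rfl) (hs j).1.2]
      simp only [Pi.add_apply, Finset.sum_add_distrib, Pi.zero_apply, Finset.sum_const_zero,
        Finset.sum_pi_single', Finset.mem_univ, if_true]
      simp
      ring
  obtain ⟨x, hx, -, htour⟩ := key J le_rfl
  simp only [Fin.is_lt, if_true] at htour
  have hpos : 0 ≤ ∑ i, δ i := Finset.sum_nonneg fun i _ => hδ i
  have h1 := htour.trans (by positivity) (by positivity)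
    (Tour.travel hv hreg hfin hx.1 hx.2 le_rfl)
  rw [← hclosed, add_zero] at h1
  convert h1 using 1
  rw [← toReal_pathELength_add hfin le_rfl hx.1 hx.2 le_rfl]
  ring

end Tours

/-! ### Continuity, homogeneity and definiteness of the observations. -/

section ObservationLemmas

variable {M : Type*} [TopologicalSpace M] {a b : ℝ} {ν : ℕ} {E : Submodule ℂ C(M, ℂ)}

theorem density_nonneg (V : C(Set.Icc a b, Fin ν → E)) (t : Set.Icc a b) (y : M) :
    0 ≤ density V t y :=
  Finset.sum_nonneg fun _ _ => by positivity

theorem density_smul (z : ℂ) (V : C(Set.Icc a b, Fin ν → E)) (t : Set.Icc a b) (y : M) :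
    density (z • V) t y = ‖z‖ ^ 2 * density V t y := by
  simp [density, Finset.mul_sum, mul_pow]

section

variable [CompactSpace M]

theorem continuous_sum_norm_sq :
    Continuous fun p : (Fin ν → E) × M => ∑ α, ‖(p.1 α : C(M, ℂ)) p.2‖ ^ 2 := by
  refine continuous_finsetSum _ fun α _ => ((Continuous.norm ?_).pow 2)
  exact Continuous.eval (by fun_prop) continuous_snd

theorem _root_.Continuous.density {X : Type*} [TopologicalSpace X]
    {ψ : X → C(Set.Icc a b, Fin ν → E)} {κ : X → Set.Icc a b} {η : X → M}
    (hψ : Continuous ψ) (hκ : Continuous κ) (hη : Continuous η) :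
    Continuous fun x => density (ψ x) (κ x) (η x) := by
  have h : Continuous fun x => (ψ x (κ x), η x) := (hψ.eval hκ).prodMk hη
  have h' := Continuous.comp continuous_sum_norm_sq h
  exact h'

end

variable [MeasurableSpace M]

theorem observation_nonneg (μ : Measure M) (V : C(Set.Icc a b, Fin ν → E)) (A : Set M)
    (t : Set.Icc a b) : 0 ≤ observation μ V A t :=
  integral_nonneg fun y => density_nonneg V t y

theorem movingObservation_nonneg (μ : Measure M) (V : C(Set.Icc a b, Fin ν → E)) (A : ℝ → Set M) :
    0 ≤ movingObservation μ V A :=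
  integral_nonneg fun t => observation_nonneg μ V (A t) t

theorem observation_smul (μ : Measure M) (z : ℂ) (V : C(Set.Icc a b, Fin ν → E)) (A : Set M)
    (t : Set.Icc a b) : observation μ (z • V) A t = ‖z‖ ^ 2 * observation μ V A t := by
  simp_rw [observation, density_smul]
  exact integral_const_mul _ _

theorem fullObservation_smul (μ : Measure M) (z : ℂ) (V : C(Set.Icc a b, Fin ν → E)) :
    fullObservation μ (z • V) = ‖z‖ ^ 2 * fullObservation μ V := by
  simp_rw [fullObservation, movingObservation, observation_smul]
  exact integral_const_mul _ _

theorem movingObservation_eq_setIntegral (hab : a ≤ b) (μ : Measure M)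
    (V : C(Set.Icc a b, Fin ν → E)) (A : ℝ → Set M) :
    movingObservation μ V A =
      ∫ t in Set.Icc a b, observation μ V (A t) (Set.projIcc a b hab t) := by
  rw [← integral_subtype_comap measurableSet_Icc]
  simp only [Set.projIcc_val]
  rfl

theorem fullObservation_eq_intervalIntegral (hab : a ≤ b) (μ : Measure M)
    (V : C(Set.Icc a b, Fin ν → E)) :
    fullObservation μ V = ∫ t in a..b, observation μ V Set.univ (Set.projIcc a b hab t) := by
  rw [fullObservation, movingObservation_eq_setIntegral hab, intervalIntegral.integral_of_le hab,
    integral_Icc_eq_integral_Ioc]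

variable [CompactSpace M]

theorem commonModulus_nonneg {G : Type*} [Group G] [MulAction G M] {J : ℕ} (μ : Measure M) (Ω : Set M) (g : Fin J → G)
    (F : Submodule ℂ C(Set.Icc a b, Fin ν → E)) (τ : ℝ) : 0 ≤ commonModulus μ Ω g F τ :=
  Real.sSup_nonneg (by rintro x ⟨V, -, t, s, -, rfl⟩; exact le_max_of_le_left (abs_nonneg _))

variable [OpensMeasurableSpace M]

theorem _root_.Continuous.observation {X : Type*} [TopologicalSpace X] [FirstCountableTopology X]
    [LocallyCompactSpace X] {ψ : X → C(Set.Icc a b, Fin ν → E)} {κ : X → Set.Icc a b}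
    (hψ : Continuous ψ) (hκ : Continuous κ) (μ : Measure M) [IsFiniteMeasure μ] (A : Set M) :
    Continuous fun x => observation μ (ψ x) A (κ x) := by
  have h := continuous_parametric_integral_of_continuous (μ := μ.restrict A)
    (f := fun (x : X) (y : M) => density (ψ x) (κ x) y)
    ((hψ.comp continuous_fst).density (hκ.comp continuous_fst) continuous_snd) isCompact_univ
  simp only [Measure.restrict_univ] at h
  exact h

theorem integrable_density (μ : Measure M) [IsFiniteMeasure μ]
    (V : C(Set.Icc a b, Fin ν → E)) (t : Set.Icc a b) : Integrable (density V t) μ := by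
  exact (continuous_const.density continuous_const continuous_id).integrable_of_hasCompactSupport
    (HasCompactSupport.of_compactSpace _)

theorem observation_le_univ (μ : Measure M) [IsFiniteMeasure μ]
    (V : C(Set.Icc a b, Fin ν → E)) (A : Set M) (t : Set.Icc a b) :
    observation μ V A t ≤ observation μ V Set.univ t :=
  setIntegral_mono_set (integrable_density μ V t).integrableOn
    (Eventually.of_forall fun y => density_nonneg V t y) (Set.subset_univ A).eventuallyLE

/-- The full observation is definite if `μ` has full support. -/
theorem fullObservation_pos (hab : a < b) (μ : Measure M)
    [IsFiniteMeasure μ] [μ.IsOpenPosMeasure] {V : C(Set.Icc a b, Fin ν → E)} (hV : V ≠ 0) :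
    0 < fullObservation μ V := by
  have : ∃ t α y, (V t α : C(M, ℂ)) y ≠ 0 := by
    contrapose! hV
    ext t α y
    exact hV t α y
  obtain ⟨t, α, y, h⟩ := this
  rw [fullObservation_eq_intervalIntegral hab.le]
  refine intervalIntegral.integral_pos hab
    (continuous_const.observation continuous_projIcc μ _).continuousOn
    (fun t _ => observation_nonneg μ V _ _) ⟨t, t.2, ?_⟩
  rw [Set.projIcc_val, observation, Measure.restrict_univ]
  refine Continuous.integral_pos_of_hasCompactSupport_nonneg_nonzero (x := y)
    (continuous_const.density continuous_const continuous_id)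
    (HasCompactSupport.of_compactSpace _) (fun y => density_nonneg V t y) (ne_of_gt ?_)
  exact Finset.sum_pos' (fun _ _ => by positivity) ⟨α, Finset.mem_univ _, by positivity⟩

theorem _root_.Continuous.fullObservation {X : Type*} [TopologicalSpace X]
    [FirstCountableTopology X] [LocallyCompactSpace X] {ψ : X → C(Set.Icc a b, Fin ν → E)}
    (hψ : Continuous ψ) (hab : a ≤ b) (μ : Measure M) [IsFiniteMeasure μ] :
    Continuous fun x => fullObservation μ (ψ x) := by
  have h := continuous_parametric_integral_of_continuous (μ := (volume : Measure ℝ))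
    (f := fun (x : X) (t : ℝ) => observation μ (ψ x) Set.univ (Set.projIcc a b hab t))
    ((hψ.comp continuous_fst).observation (continuous_projIcc.comp continuous_snd) μ Set.univ)
    (isCompact_Icc (a := a) (b := b))
  refine h.congr fun x => ?_
  rw [MovingObserver.fullObservation, movingObservation_eq_setIntegral hab]

/-- The level sets of a positive definite continuous function, homogeneous of degree two, are
bounded. -/
theorem exists_norm_le_of_homogeneous {W : Type*} [NormedAddCommGroup W] [NormedSpace ℂ W]
    [ProperSpace W] {q : W → ℝ} (hq : Continuous q) (hsmul : ∀ (z : ℂ) w, q (z • w) = ‖z‖ ^ 2 * q w)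
    (hpos : ∀ w, w ≠ 0 → 0 < q w) : ∃ r : ℝ, ∀ w, q w = 1 → ‖w‖ ≤ r := by
  obtain ⟨m, hm, hmq⟩ : ∃ m : ℝ, 0 < m ∧ ∀ w, ‖w‖ = 1 → m ≤ q w := by
    rcases (Metric.sphere (0 : W) 1).eq_empty_or_nonempty with h0 | hne
    -- The sphere is empty when `W` is trivial, which occurs for `F = 0`; any `m` will do.
    · exact ⟨1, one_pos, fun w hw => by
        have : w ∈ Metric.sphere (0 : W) 1 := by simpa using hw
        simp [h0] at this⟩
    · obtain ⟨w₀, hw₀, hmin⟩ := (isCompact_sphere (0 : W) 1).exists_isMinOn hne hq.continuousOn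
      refine ⟨_, hpos w₀ ?_, fun w hw => hmin (by simpa using hw)⟩
      rintro rfl
      simp at hw₀
  refine ⟨Real.sqrt m⁻¹, fun w hw => Real.le_sqrt_of_sq_le ?_⟩
  rcases eq_or_ne w 0 with h0 | h0
  · simp [h0, hm.le]
  have hn : 0 < ‖w‖ := norm_pos_iff.2 h0
  have h1 := hmq (((‖w‖⁻¹ : ℝ) : ℂ) • w) (by
    rw [norm_smul, Complex.norm_real, norm_inv, norm_norm, inv_mul_cancel₀ hn.ne'])
  rw [hsmul, Complex.norm_real, norm_inv, norm_norm, hw, mul_one, inv_pow] at h1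
  exact (le_inv_comm₀ hm (by positivity)).1 h1

/-- Coordinates move the compactness argument to `ℂⁿ`, where closed balls are compact and every
linear map out is continuous. -/
theorem exists_continuous_linear_parametrization {W : Type*} [AddCommGroup W] [Module ℂ W]
    [TopologicalSpace W] [IsTopologicalAddGroup W] [ContinuousSMul ℂ W] (F : Submodule ℂ W)
    [FiniteDimensional ℂ F] :
    ∃ (n : ℕ) (L : (Fin n → ℂ) →ₗ[ℂ] W), Continuous L ∧ LinearMap.ker L = ⊥ ∧
      LinearMap.range L = F := by
  let e := (Module.finBasis ℂ F).equivFun.symm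
  refine ⟨_, F.subtype.comp e.toLinearMap, LinearMap.continuous_on_pi _, ?_, ?_⟩
  · rw [LinearMap.ker_comp, Submodule.ker_subtype]; exact e.ker
  · rw [LinearMap.range_comp_of_range_eq_top _ e.range, Submodule.range_subtype]

/-- The unit observation set is contained in the continuous image of a compact set. -/
theorem exists_parametrization (hab : a < b) (μ : Measure M) [IsFiniteMeasure μ]
    [μ.IsOpenPosMeasure] (F : Submodule ℂ C(Set.Icc a b, Fin ν → E)) [FiniteDimensional ℂ F] :
    ∃ (n : ℕ) (L : (Fin n → ℂ) → C(Set.Icc a b, Fin ν → E)) (r : ℝ), Continuous L ∧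
      unitObservationSet μ F ⊆ L '' Metric.closedBall 0 r := by
  obtain ⟨n, L, hL, hker, hrange⟩ := exists_continuous_linear_parametrization F
  obtain ⟨r, hr⟩ := exists_norm_le_of_homogeneous (hL.fullObservation hab.le μ)
    (fun z w => by rw [map_smul, fullObservation_smul])
    (fun w hw => fullObservation_pos hab μ fun h => hw (LinearMap.ker_eq_bot'.1 hker w h))
  refine ⟨n, L, r, hL, fun V hV => ?_⟩
  obtain ⟨w, rfl⟩ : V ∈ LinearMap.range L := hrange ▸ hV.1
  exact ⟨w, mem_closedBall_zero_iff.2 (hr _ hV.2), rfl⟩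

theorem exists_delta_observation (hab : a < b) (μ : Measure M) [IsFiniteMeasure μ]
    [μ.IsOpenPosMeasure] (F : Submodule ℂ C(Set.Icc a b, Fin ν → E)) [FiniteDimensional ℂ F]
    (A : Set M) {ε : ℝ} (hε : 0 < ε) :
    ∃ δ > 0, ∀ V ∈ unitObservationSet μ F, ∀ t s : Set.Icc a b, |(t : ℝ) - s| < δ →
      |observation μ V A t - observation μ V A s| < ε := by
  obtain ⟨n, L, r, hL, hS⟩ := exists_parametrization hab μ F
  have h := ((isCompact_closedBall (0 : Fin n → ℂ) r).prod
    (isCompact_univ (X := Set.Icc a b))).uniformContinuousOn_of_continuous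
    ((hL.comp continuous_fst).observation continuous_snd μ A).continuousOn
  obtain ⟨δ, hδ, h⟩ := Metric.uniformContinuousOn_iff.1 h ε hε
  refine ⟨δ, hδ, fun V hV t s hts => ?_⟩
  obtain ⟨w, hw, rfl⟩ := hS hV
  have := h (w, t) ⟨hw, trivial⟩ (w, s) ⟨hw, trivial⟩ (by
    rw [Prod.dist_eq, dist_self, max_lt_iff]
    exact ⟨hδ, by rwa [Subtype.dist_eq, Real.dist_eq]⟩)
  rwa [Real.dist_eq] at this

/-! ### The common modulus of continuity. -/

section Modulus

variable {G : Type*} [Group G] [MulAction G M] {J : ℕ}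

theorem bddAbove_oscillationSet (hab : a < b)
    (μ : Measure M) [IsFiniteMeasure μ] [μ.IsOpenPosMeasure] (Ω : Set M) (g : Fin J → G)
    (F : Submodule ℂ C(Set.Icc a b, Fin ν → E)) [FiniteDimensional ℂ F] (τ : ℝ) :
    BddAbove (oscillationSet μ Ω g F τ) := by
  obtain ⟨n, L, r, hL, hS⟩ := exists_parametrization hab μ F
  obtain ⟨B, hB⟩ := ((isCompact_closedBall (0 : Fin n → ℂ) r).prod
    (isCompact_univ (X := Set.Icc a b))).bddAbove_image
    ((hL.comp continuous_fst).observation continuous_snd μ Set.univ).continuousOn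
  have key : ∀ V ∈ unitObservationSet μ F, ∀ (t s : Set.Icc a b) (A : Set M),
      |observation μ V A t - observation μ V A s| ≤ max B 0 := by
    intro V hV t s A
    obtain ⟨w, hw, rfl⟩ := hS hV
    have h : ∀ t, observation μ (L w) A t ≤ B := fun t =>
      (observation_le_univ μ _ A t).trans
      (hB ⟨(w, t), ⟨hw, trivial⟩, rfl⟩)
    rw [abs_le]
    have h1 := h t
    have h2 := h s
    have h3 := observation_nonneg μ (L w) A t
    have h4 := observation_nonneg μ (L w) A s
    have h5 := le_max_left B 0
    constructor <;> linarith
  -- The `0` covers the supremum over `j` when `J = 0`, which is `0` by convention.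
  refine ⟨max B 0, ?_⟩
  rintro x ⟨V, hV, t, s, -, rfl⟩
  exact max_le (key V hV t s _) (Real.iSup_le (fun j => key V hV t s _) (le_max_right _ _))

theorem exists_delta_commonModulus (hab : a < b)
    (μ : Measure M) [IsFiniteMeasure μ] [μ.IsOpenPosMeasure] (Ω : Set M) (g : Fin J → G)
    (F : Submodule ℂ C(Set.Icc a b, Fin ν → E)) [FiniteDimensional ℂ F] {ε : ℝ} (hε : 0 < ε) :
    ∃ δ > 0, ∀ τ < δ, commonModulus μ Ω g F τ ≤ ε := by
  obtain ⟨δ₀, hδ₀, h₀⟩ := exists_delta_observation hab μ F Set.univ hε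
  choose δ hδ h using fun j => exists_delta_observation hab μ F (g j • Ω) hε
  obtain ⟨η, hη, hηδ⟩ : ∃ η > 0, ∀ j, η ≤ δ j := by
    rcases isEmpty_or_nonempty (Fin J) with hJ | hJ
    · exact ⟨1, one_pos, fun j => hJ.elim j⟩
    · exact ⟨Finset.univ.inf' Finset.univ_nonempty δ,
        (Finset.lt_inf'_iff _).2 fun j _ => hδ j, fun j => Finset.inf'_le _ (Finset.mem_univ j)⟩
  refine ⟨min δ₀ η, lt_min hδ₀ hη, fun τ hτ => Real.sSup_le ?_ hε.le⟩
  rintro x ⟨V, hV, t, s, hts, rfl⟩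
  have hlt := hts.trans_lt hτ
  exact max_le (h₀ V hV t s (hlt.trans_le (min_le_left _ _))).le
    (Real.iSup_le (fun j => (h j V hV t s
      (hlt.trans_le ((min_le_right _ _).trans (hηδ j)))).le) hε.le)

/-- The observations are homogeneous of degree two, so the bound for `V / √N`, which lies in the
unit set, scales by `N`. -/
theorem max_oscillation_le (hab : a < b)
    (μ : Measure M) [IsFiniteMeasure μ] [μ.IsOpenPosMeasure] (Ω : Set M) (g : Fin J → G)
    (F : Submodule ℂ C(Set.Icc a b, Fin ν → E)) [FiniteDimensional ℂ F]
    {V : C(Set.Icc a b, Fin ν → E)} (hV : V ∈ F) (hN : 0 < fullObservation μ V) {τ : ℝ}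
    {t s : Set.Icc a b} (hts : |(t : ℝ) - s| ≤ τ) :
    |observation μ V Set.univ t - observation μ V Set.univ s| ≤
        fullObservation μ V * commonModulus μ Ω g F τ ∧
      ∀ j, |observation μ V (g j • Ω) t - observation μ V (g j • Ω) s| ≤
        fullObservation μ V * commonModulus μ Ω g F τ := by
  set N := fullObservation μ V with hNdef
  set z : ℂ := (((Real.sqrt N)⁻¹ : ℝ) : ℂ) with hz
  have hz2 : ‖z‖ ^ 2 = N⁻¹ := by
    rw [hz, Complex.norm_real, norm_inv, inv_pow, Real.norm_eq_abs, sq_abs, Real.sq_sqrt hN.le]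
  have hmem : z • V ∈ unitObservationSet μ F :=
    ⟨F.smul_mem z hV, by rw [fullObservation_smul, hz2, inv_mul_cancel₀ hN.ne']⟩
  have hle := le_csSup (bddAbove_oscillationSet hab μ Ω g F τ) ⟨z • V, hmem, t, s, hts, rfl⟩
  simp only [observation_smul, hz2, ← mul_sub, abs_mul, abs_of_pos (inv_pos.2 hN)] at hle
  have hA : ∀ x, N⁻¹ * x ≤ commonModulus μ Ω g F τ → x ≤ N * commonModulus μ Ω g F τ :=
    fun x hx => by rwa [inv_mul_le_iff₀ hN] at hx
  refine ⟨hA _ ((le_max_left _ _).trans hle), fun j => hA _ (le_trans ?_ hle)⟩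
  exact le_trans (le_ciSup (f := fun j => N⁻¹ *
    |observation μ V (g j • Ω) t - observation μ V (g j • Ω) s|)
    (Set.finite_range _).bddAbove j) (le_max_right _ _)

end Modulus

/-! ### Measurability in time of the moving observation. -/

section Moving

variable {G : Type*} [Group G] [TopologicalSpace G] [ContinuousInv G] [MulAction G M]
  [ContinuousSMul G M]

/-- The observation along a continuous path of subsets `f t • Ω` is an integral over time of
a measurable bounded function. -/
theorem ofReal_movingObservation_smul [BorelSpace M] (hab : a ≤ b) (μ : Measure M)
    [IsFiniteMeasure μ] {Ω : Set M} (hΩ : MeasurableSet Ω)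
    (V : C(Set.Icc a b, Fin ν → E)) {f : ℝ → G} (hf : ContinuousOn f (Set.Icc a b)) :
    ENNReal.ofReal (movingObservation μ V fun t => f t • Ω) =
      ∫⁻ t in Set.Ioc a b,
        ENNReal.ofReal (observation μ V (f t • Ω) (Set.projIcc a b hab t)) := by
  have hfc : Continuous fun t : Set.Icc a b => f t := continuousOn_iff_continuous_domRestrict.1 hf
  -- This set is the preimage of `Ω` under a continuous map of `(t, y)`, and its section at `t` is
  -- `f t • Ω`; measurability in `t` follows by integrating over `y`.
  have hSmeas : MeasurableSet {p : Set.Icc a b × M | (f p.1)⁻¹ • p.2 ∈ Ω} :=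
    ((hfc.comp continuous_fst).inv.smul continuous_snd).measurable hΩ
  have hmeas : StronglyMeasurable fun t : Set.Icc a b => observation μ V (f t • Ω) t := by
    have h := ((continuous_const.density (ψ := fun _ => V) continuous_fst continuous_snd).measurable.indicator hSmeas).stronglyMeasurable
      |>.integral_prod_right' (ν := μ)
    convert h using 2 with t
    have hset : f t • Ω = {y : M | (f t)⁻¹ • y ∈ Ω} := by
      ext y; exact Set.mem_smul_set_iff_inv_smul_mem
    have hset' : MeasurableSet (f t • Ω) := by
      rw [hset]; exact (measurable_const_smul (f t)⁻¹) hΩ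
    rw [observation, ← integral_indicator hset', hset]
    rfl
  have : IsFiniteMeasure (Measure.comap ((↑) : Set.Icc a b → ℝ) volume) := ⟨by
    rw [Measure.comap_apply _ Subtype.val_injective
      (fun s hs => (MeasurableEmbedding.subtype_coe measurableSet_Icc).measurableSet_image.2 hs) _
      MeasurableSet.univ, Set.image_univ, Subtype.range_coe]
    exact measure_Icc_lt_top⟩
  obtain ⟨B, hB⟩ := (isCompact_univ (X := Set.Icc a b)).bddAbove_image
    (continuous_const.observation (ψ := fun _ => V) continuous_id μ Set.univ).continuousOn
  have hint : Integrable (fun t : Set.Icc a b => observation μ V (f t • Ω) t)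
      (Measure.comap ((↑) : Set.Icc a b → ℝ) volume) :=
    Integrable.of_bound hmeas.aestronglyMeasurable B (Eventually.of_forall fun t => by
      rw [Real.norm_eq_abs, abs_of_nonneg (observation_nonneg μ V _ t)]
      exact (observation_le_univ μ V _ t).trans (hB ⟨t, trivial, rfl⟩))
  rw [movingObservation, ofReal_integral_eq_lintegral_ofReal hint
    (Eventually.of_forall fun t => observation_nonneg μ V _ t), restrict_Ioc_eq_restrict_Icc,
    ← lintegral_subtype_comap measurableSet_Icc]
  simp only [Set.projIcc_val]

end Moving

end ObservationLemmas

/-! ### Realizing the design by `R` turns. -/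

section Realization

/-- Exactness is applied to each component `V t α`, an element of `E`, and summed over `α`. -/
theorem IsExactDesign.observation_eq {M : Type*} [TopologicalSpace M] [CompactSpace M]
    [MeasurableSpace M] [OpensMeasurableSpace M] {a b : ℝ} {ν : ℕ} {E : Submodule ℂ C(M, ℂ)}
    {G : Type*} [Group G] [MulAction G M] {J : ℕ} {μ : Measure M} [IsFiniteMeasure μ] {Ω : Set M}
    {g : Fin J → G} {θ : Fin J → ℝ} (h : IsExactDesign μ Ω E g θ)
    (V : C(Set.Icc a b, Fin ν → E)) (t : Set.Icc a b) :
    ∑ j, θ j * observation μ V (g j • Ω) t = μ.real Ω * observation μ V Set.univ t := by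
  have hint : ∀ α : Fin ν, Integrable (fun y => ‖(V t α : C(M, ℂ)) y‖ ^ 2) μ := fun α =>
    Continuous.integrable_of_hasCompactSupport (by fun_prop) (HasCompactSupport.of_compactSpace _)
  have hobs : ∀ A : Set M, observation μ V A t =
      ∑ α, ∫ y in A, ‖(V t α : C(M, ℂ)) y‖ ^ 2 ∂μ := fun A =>
    integral_finsetSum _ fun α _ => (hint α).integrableOn
  simp only [hobs, Finset.mul_sum, Measure.restrict_univ]
  rw [Finset.sum_comm]
  exact Finset.sum_congr rfl fun α _ => h.exact _ (V t α).2

theorem ofReal_sum_le_sum_ofReal {ι : Type*} (s : Finset ι) (f : ι → ℝ) :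
    ENNReal.ofReal (∑ i ∈ s, f i) ≤ ∑ i ∈ s, ENNReal.ofReal (f i) :=
  Finset.le_sum_of_subadditive _ ENNReal.ofReal_zero.le (fun _ _ => ENNReal.ofReal_add_le) _ _

/-- Comparison of an integral with a left Riemann sum. -/
theorem integral_le_riemannSum {φ : ℝ → ℝ} (hφ : Continuous φ) {a τ η : ℝ} (hτ : 0 ≤ τ) (R : ℕ)
    (h : ∀ r < R, ∀ t ∈ Set.Icc (a + r * τ) (a + (r + 1) * τ), φ t ≤ φ (a + r * τ) + η) :
    ∫ t in a..a + R * τ, φ t ≤ τ * (∑ r ∈ Finset.range R, φ (a + r * τ) + R * η) := by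
  have hsum := intervalIntegral.sum_integral_adjacent_intervals (μ := volume) (f := φ)
    (a := fun r : ℕ => a + r * τ) (n := R) fun r _ => hφ.intervalIntegrable _ _
  simp only [Nat.cast_zero, zero_mul, add_zero] at hsum
  rw [← hsum]
  calc ∑ r ∈ Finset.range R, ∫ t in (a + r * τ)..(a + (r + 1 : ℕ) * τ), φ t
      ≤ ∑ r ∈ Finset.range R, τ * (φ (a + r * τ) + η) := Finset.sum_le_sum fun r hr => by
        have hle : a + r * τ ≤ a + (r + 1 : ℕ) * τ := by push_cast; nlinarith
        have h1 := intervalIntegral.integral_mono_on hle (hφ.intervalIntegrable (μ := volume) _ _)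
          (intervalIntegrable_const (c := φ (a + r * τ) + η))
          fun t ht => h r (Finset.mem_range.1 hr) t (by simpa using ht)
        rw [intervalIntegral.integral_const, smul_eq_mul] at h1
        refine h1.trans_eq ?_
        push_cast; ring
    _ = _ := by
        rw [← Finset.mul_sum, Finset.sum_add_distrib, Finset.sum_const, Finset.card_range,
          nsmul_eq_mul]

variable {H : Type*} [NormedAddCommGroup H] [NormedSpace ℝ H]
  {G : Type*} [Group G] [TopologicalSpace G] [IsTopologicalGroup G] [ChartedSpace H G]
  [IsManifold 𝓘(ℝ, H) ∞ G]
  [RiemannianBundle (fun x : G => TangentSpace 𝓘(ℝ, H) x)]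
  [IsContMDiffRiemannianBundle 𝓘(ℝ, H) ∞ H (fun x : G => TangentSpace 𝓘(ℝ, H) x)]
  {M : Type*} [TopologicalSpace M] [CompactSpace M] [MeasurableSpace M] [BorelSpace M]
  [MulAction G M] [ContinuousSMul G M] {μ : Measure M} [IsFiniteMeasure μ] [μ.IsOpenPosMeasure]
  {Ω : Set M} {a b : ℝ} {ν : ℕ} {E : Submodule ℂ C(M, ℂ)}
  {F : Submodule ℂ C(Set.Icc a b, Fin ν → E)} [FiniteDimensional ℂ F]
  {J : ℕ} {g : Fin J → G} {θ : Fin J → ℝ}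

/-- The convexified design is realized, up to the error `realizationError`, by `R` turns around
the cycle. -/
theorem exists_path_realizing (hΩ : MeasurableSet Ω) (hab : a < b)
    (hdesign : IsExactDesign μ Ω E g θ) {c d : ℝ} {γ : ℝ → G} (hγ : IsCycleThrough H γ c d g)
    {D : ℝ} (hD0 : 0 ≤ D) (hD : Manifold.pathELength 𝓘(ℝ, H) γ c d = ENNReal.ofReal D)
    {v : ℝ} (hv : 0 < v) {R : ℕ} (hR : 1 ≤ R) (hRD : R * D < v * (b - a)) :
    ∃ f : ℝ → G, IsPiecewiseSmooth H f a b ∧ SpeedLE H f a b v ∧ ∀ V ∈ F,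
      (μ.real Ω - realizationError μ Ω g F D v R) * fullObservation μ V
        ≤ movingObservation μ V (fun t => f t • Ω) := by
  have hR0 : (0 : ℝ) < R := by exact_mod_cast hR
  have hba : 0 < b - a := sub_pos.2 hab
  set τ := (b - a) / R with hτ
  have hτ0 : 0 < τ := div_pos hba hR0
  have hRτ : R * τ = b - a := by rw [hτ]; field_simp
  -- `x = (D / v) / τ` is the fraction of each period spent travelling; `κ` is the time left for
  -- resting.
  set x := D * R / (v * (b - a)) with hx
  have hx0 : 0 ≤ x := by positivity
  have hx1 : x < 1 := by rw [hx, div_lt_one (by positivity)]; linarith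
  set κ := τ * (1 - x) with hκ
  have hκ0 : 0 < κ := mul_pos hτ0 (by linarith)
  have htime : D / v + ∑ i, θ i * κ = τ := by
    rw [← Finset.sum_mul, hdesign.weight_sum, hκ, hx, hτ]
    field_simp
    ring
  have htour := Tour.cycle hv hγ (hD ▸ ENNReal.ofReal_ne_top)
    fun i => (mul_pos (hdesign.weight_pos i) hκ0).le
  rw [hD, ENNReal.toReal_ofReal hD0, htime] at htour
  obtain ⟨f, hf, hspeed, -, hΨ⟩ := htour.exists_repeat hv.le hτ0.le a R
  have hend : a + R * τ = b := by linarith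
  rw [hend] at hf hspeed hΨ
  refine ⟨f, hf, hspeed, fun V hV => ?_⟩
  set N := fullObservation μ V with hN
  have hNnn : 0 ≤ N := movingObservation_nonneg μ V fun _ => Set.univ
  rcases hNnn.eq_or_lt with hN0 | hN0
  · rw [← hN0, mul_zero]; exact movingObservation_nonneg μ V _
  set η := N * commonModulus μ Ω g F τ with hη
  have hη0 : 0 ≤ η := mul_nonneg hN0.le (commonModulus_nonneg μ Ω g F τ)
  set Φ : Set M → ℝ → ℝ := fun A t => observation μ V A (Set.projIcc a b hab.le t) with hΦ
  have hosc : ∀ r < R, ∀ t ∈ Set.Icc (a + r * τ) (a + (r + 1) * τ),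
      |Φ Set.univ t - Φ Set.univ (a + r * τ)| ≤ η ∧
        ∀ i, |Φ (g i • Ω) t - Φ (g i • Ω) (a + r * τ)| ≤ η := by
    intro r hr t ht
    have h0 : 0 ≤ r * τ := by positivity
    have h1 : ((r : ℝ) + 1) * τ ≤ R * τ :=
      mul_le_mul_of_nonneg_right (by exact_mod_cast hr) hτ0.le
    refine max_oscillation_le hab μ Ω g F hV hN0 (τ := τ) ?_
    rw [Set.projIcc_of_mem _ ⟨by linarith [ht.1], by linarith [ht.2]⟩,
      Set.projIcc_of_mem _ ⟨by linarith [ht.1], by linarith [ht.1, ht.2]⟩]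
    rw [abs_le]
    constructor <;> linarith [ht.1, ht.2]
  have hlower : ∑ r ∈ Finset.range R, ∑ i, θ i * κ * (Φ (g i • Ω) (a + r * τ) - η) ≤
      movingObservation μ V (fun t => f t • Ω) := by
    rw [← ENNReal.ofReal_le_ofReal_iff (movingObservation_nonneg μ V _),
      ofReal_movingObservation_smul hab.le μ hΩ V hf.1]
    -- The bounds `m r i` are renewed at each turn from the values at its start. Truncation by
    -- `ENNReal.ofReal` only increases the sum, so `F_j(t_r) - η` may be negative.
    refine le_trans ?_ (hΨ (fun t h => ENNReal.ofReal (Φ (h • Ω) t))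
      (fun r i => ENNReal.ofReal (Φ (g i • Ω) (a + r * τ) - η)) fun r hr i t ht => ?_)
    · refine (ofReal_sum_le_sum_ofReal _ _).trans (Finset.sum_le_sum fun r _ =>
        (ofReal_sum_le_sum_ofReal _ _).trans (Finset.sum_le_sum fun i _ => ?_))
      rw [ENNReal.ofReal_mul (mul_pos (hdesign.weight_pos i) hκ0).le]
    · refine ENNReal.ofReal_le_ofReal ?_
      have := (abs_le.1 ((hosc r hr t ht).2 i)).1
      linarith
  have hdes : ∀ t, ∑ i, θ i * κ * (Φ (g i • Ω) t - η) =
      κ * (μ.real Ω * Φ Set.univ t - η) := by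
    intro t
    rw [hΦ, ← hdesign.observation_eq V, mul_sub, Finset.mul_sum]
    simp_rw [mul_sub]
    rw [Finset.sum_sub_distrib, ← Finset.sum_mul, ← Finset.sum_mul, hdesign.weight_sum, one_mul]
    congr 1
    exact Finset.sum_congr rfl fun i _ => by ring
  simp only [hdes] at hlower
  rw [← Finset.mul_sum, Finset.sum_sub_distrib, ← Finset.mul_sum, Finset.sum_const,
    Finset.card_range, nsmul_eq_mul] at hlower
  have hupper := integral_le_riemannSum (φ := Φ Set.univ)
    (continuous_const.observation continuous_projIcc μ _) hτ0.le R (η := η) fun r hr t ht => by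
      have := (abs_le.1 (hosc r hr t ht).1).2
      linarith
  rw [hend, ← fullObservation_eq_intervalIntegral hab.le, ← hN] at hupper
  set S := ∑ r ∈ Finset.range R, Φ Set.univ (a + r * τ) with hS
  refine le_trans ?_ hlower
  set ℓ := μ.real Ω with hℓ
  have hℓ0 : 0 ≤ ℓ := measureReal_nonneg
  have herr : realizationError μ Ω g F D v R * N = ℓ * x * N + (ℓ + 1) * (b - a) * η := by
    rw [realizationError, ← hℓ, ← hx, ← hτ, hη]; ring
  have h1 : ℓ * N - ℓ * (b - a) * η ≤ ℓ * (τ * S) := by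
    have : N ≤ τ * S + (b - a) * η := by rw [← hRτ]; linarith
    have := mul_le_mul_of_nonneg_left this hℓ0
    linarith
  have h2 : (1 - x) * (ℓ * N - ℓ * (b - a) * η - (b - a) * η) ≤ κ * (ℓ * S - R * η) := by
    have : κ * (ℓ * S - R * η) = (1 - x) * (ℓ * (τ * S) - (b - a) * η) := by
      rw [hκ, ← hRτ]; ring
    rw [this]
    exact mul_le_mul_of_nonneg_left (by linarith) (by linarith)
  -- The true loss carries a factor `1 - x` on the modulus term; dropping it leaves the stated
  -- error.
  have h3 : 0 ≤ x * ((ℓ + 1) * (b - a) * η) := by positivity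
  rw [sub_mul, herr]
  linarith


end Realization

/-! ### Choice of the number of turns. -/

section Limit

variable {M : Type*} [TopologicalSpace M] [CompactSpace M] [MeasurableSpace M]
  [OpensMeasurableSpace M] {G : Type*} [Group G] [MulAction G M] {a b : ℝ} {ν : ℕ}
  {E : Submodule ℂ C(M, ℂ)} {J : ℕ}

/-- With `R = ⌊√v⌋₊` one has `R / v ≤ 1 / √v`, while `|I| / R` still tends to `0`. -/
theorem tendsto_realizationError_floor_sqrt (hab : a < b) (μ : Measure M) [IsFiniteMeasure μ]
    [μ.IsOpenPosMeasure] (Ω : Set M) (g : Fin J → G)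
    (F : Submodule ℂ C(Set.Icc a b, Fin ν → E)) [FiniteDimensional ℂ F] (D : ℝ) :
    Tendsto (fun v => realizationError μ Ω g F D v ⌊√v⌋₊) atTop (𝓝 0) := by
  have hfloor : Tendsto (fun v : ℝ => ⌊√v⌋₊) atTop atTop :=
    tendsto_nat_floor_atTop.comp Real.tendsto_sqrt_atTop
  have h1 : Tendsto (fun v : ℝ => (⌊√v⌋₊ : ℝ) / v) atTop (𝓝 0) := by
    refine squeeze_zero' ?_ ?_ (tendsto_inv_atTop_zero.comp Real.tendsto_sqrt_atTop)
    · filter_upwards [eventually_ge_atTop 0] with v hv using by positivity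
    · filter_upwards [eventually_gt_atTop 0] with v hv
      rw [Function.comp_apply, div_le_iff₀ hv]
      calc (⌊√v⌋₊ : ℝ) ≤ √v := Nat.floor_le (Real.sqrt_nonneg v)
        _ = (√v)⁻¹ * v := by
          nth_rewrite 3 [← Real.mul_self_sqrt hv.le]
          rw [inv_mul_cancel_left₀ (Real.sqrt_pos.2 hv).ne']
  have h2 : Tendsto (fun v : ℝ => commonModulus μ Ω g F ((b - a) / ⌊√v⌋₊)) atTop (𝓝 0) := by
    have hdiv : Tendsto (fun v : ℝ => (b - a) / ⌊√v⌋₊) atTop (𝓝 0) :=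
      (tendsto_natCast_atTop_atTop.comp hfloor).const_div_atTop (b - a)
    rw [Metric.tendsto_nhds]
    intro ε hε
    obtain ⟨δ, hδ, h⟩ := exists_delta_commonModulus hab μ Ω g F (half_pos hε)
    filter_upwards [hdiv.eventually_lt_const hδ] with v hv
    rw [Real.dist_eq, sub_zero, abs_of_nonneg (commonModulus_nonneg μ Ω g F _)]
    linarith [h _ hv]
  have h3 := (h1.const_mul (μ.real Ω * D / (b - a))).add
    (h2.const_mul ((μ.real Ω + 1) * (b - a)))
  simp only [mul_zero, add_zero] at h3
  refine h3.congr fun v => ?_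
  rw [realizationError]
  congr 1
  rw [div_mul_div_comm, mul_comm v (b - a)]
  ring

/-- The number of turns can be chosen so that the realization error vanishes at infinite speed. -/
theorem exists_turns (hab : a < b) (μ : Measure M) [IsFiniteMeasure μ]
    [μ.IsOpenPosMeasure] (Ω : Set M) (g : Fin J → G)
    (F : Submodule ℂ C(Set.Icc a b, Fin ν → E)) [FiniteDimensional ℂ F] (D : ℝ) :
    ∃ ρ : ℝ → ℕ, Tendsto (fun v => realizationError μ Ω g F D v (ρ v)) atTop (𝓝 0) ∧
      ∀ v, D / (b - a) < v → 1 ≤ ρ v ∧ ρ v * D < v * (b - a) := by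
  classical
  have hba : 0 < b - a := sub_pos.2 hab
  -- A single turn is admissible as soon as `D / |I| < v`; it serves where `⌊√v⌋₊` is not
  -- admissible, which never happens for large `v`.
  refine ⟨fun v => if 1 ≤ ⌊√v⌋₊ ∧ ⌊√v⌋₊ * D < v * (b - a) then ⌊√v⌋₊ else 1,
    (tendsto_realizationError_floor_sqrt hab μ Ω g F D).congr' ?_, fun v hv => ?_⟩
  · filter_upwards [eventually_gt_atTop 0,
      Real.tendsto_sqrt_atTop.eventually_gt_atTop (max 1 (|D| / (b - a)))] with v hv0 hv
    have hs1 : 1 ≤ √v := ((le_max_left _ _).trans_lt hv).le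
    have hs2 : |D| < √v * (b - a) := (div_lt_iff₀ hba).1 ((le_max_right _ _).trans_lt hv)
    have hlt : (⌊√v⌋₊ : ℝ) * D < v * (b - a) := by
      calc (⌊√v⌋₊ : ℝ) * D ≤ ⌊√v⌋₊ * |D| :=
            mul_le_mul_of_nonneg_left (le_abs_self D) (by positivity)
        _ ≤ √v * |D| :=
            mul_le_mul_of_nonneg_right (Nat.floor_le (Real.sqrt_nonneg v)) (abs_nonneg D)
        _ < √v * (√v * (b - a)) := mul_lt_mul_of_pos_left hs2 (by linarith)
        _ = v * (b - a) := by rw [← mul_assoc, Real.mul_self_sqrt hv0.le]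
    rw [if_pos ⟨Nat.le_floor (by simpa using hs1), hlt⟩]
  · simp only
    split_ifs with h
    · exact h
    · exact ⟨le_rfl, by rw [Nat.cast_one, one_mul]; exact (div_lt_iff₀ hba).1 hv⟩

end Limit

end MovingObserver

theorem mainTheorem5
    -- a compact connected Lie group with a right-invariant (smooth) Riemannian metric
    {H : Type*} [NormedAddCommGroup H] [NormedSpace ℝ H] [FiniteDimensional ℝ H]
    {G : Type*} [Group G] [TopologicalSpace G] [ChartedSpace H G] [LieGroup 𝓘(ℝ, H) ∞ G]
    [T2Space G] [CompactSpace G] [ConnectedSpace G]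
    [RiemannianBundle (fun x : G => TangentSpace 𝓘(ℝ, H) x)]
    [IsContMDiffRiemannianBundle 𝓘(ℝ, H) ∞ H (fun x : G => TangentSpace 𝓘(ℝ, H) x)]
    (_hmetric : MovingObserver.IsRightInvariantMetric H G)
    -- the compact measured homogeneous space
    {M : Type*} [TopologicalSpace M] [CompactSpace M] [T2Space M]
    [MeasurableSpace M] [BorelSpace M]
    [MulAction G M] [ContinuousSMul G M] [MulAction.IsPretransitive G M]
    (μ : Measure M) [IsProbabilityMeasure μ] [SMulInvariantMeasure G M μ]
    -- the prototype observation subset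
    (Ω : Set M) (_hΩ : MeasurableSet Ω) (_hL : 0 < μ Ω)
    -- the time interval, the profile space and the trajectory space
    (a b : ℝ) (_hab : a < b) (ν : ℕ) (_hν : 0 < ν)
    (E : Submodule ℂ C(M, ℂ)) [FiniteDimensional ℂ E]
    (F : Submodule ℂ C(Set.Icc a b, Fin ν → E)) [FiniteDimensional ℂ F]
    -- the exact convexified design
    (J : ℕ) (g : Fin J → G) (θ : Fin J → ℝ)
    (_hdesign : MovingObserver.IsExactDesign μ Ω E g θ)
    -- the cycle through the design points, of length `D`
    (c d : ℝ) (γ : ℝ → G) (_hγ : MovingObserver.IsCycleThrough H γ c d g)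
    (D : ℝ) (_hD0 : 0 ≤ D)
    (_hD : Manifold.pathELength 𝓘(ℝ, H) γ c d = ENNReal.ofReal D) :
    (∀ τ : ℝ, BddAbove (MovingObserver.oscillationSet μ Ω g F τ)) ∧
    ∃ path : ℝ → ℕ → ℝ → G,
      (∀ v : ℝ, D / (b - a) < v → ∀ R : ℕ, 1 ≤ R → R * D < v * (b - a) →
        MovingObserver.IsPiecewiseSmooth H (path v R) a b ∧
        MovingObserver.SpeedLE H (path v R) a b v ∧
        ∀ V ∈ F,
          (μ.real Ω - MovingObserver.realizationError μ Ω g F D v R)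
              * MovingObserver.fullObservation μ V
            ≤ MovingObserver.movingObservation μ V (fun t => path v R t • Ω)) ∧
      ∃ (ε : ℝ → ℝ) (ρ : ℝ → ℕ),
        Tendsto ε atTop (𝓝 0) ∧
        ∀ v : ℝ, D / (b - a) < v →
          1 ≤ ρ v ∧ ρ v * D < v * (b - a) ∧
          ∀ V ∈ F,
            (μ.real Ω - ε v) * MovingObserver.fullObservation μ V
              ≤ MovingObserver.movingObservation μ V (fun t => path v (ρ v) t • Ω) := by
  have hgroup : IsTopologicalGroup G := topologicalGroup_of_lieGroup 𝓘(ℝ, H) ∞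
  have hman : IsManifold 𝓘(ℝ, H) ∞ G := inferInstance
  -- By transitivity and compactness, finitely many translates of a nonempty open set cover `M`;
  -- they have equal measure, so it is positive.
  have hopen : μ.IsOpenPosMeasure := ⟨fun U hU hne =>
    (measure_isOpen_pos_of_smulInvariant_of_compact_ne_zero G isCompact_univ
      (by simp) hU hne).ne'⟩
  have hba : 0 < b - a := sub_pos.2 _hab
  refine ⟨MovingObserver.bddAbove_oscillationSet _hab μ Ω g F, ?_⟩
  have hex : ∀ (v : ℝ) (R : ℕ), ∃ f : ℝ → G, D / (b - a) < v → 1 ≤ R → R * D < v * (b - a) →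
      MovingObserver.IsPiecewiseSmooth H f a b ∧ MovingObserver.SpeedLE H f a b v ∧ ∀ V ∈ F,
        (μ.real Ω - MovingObserver.realizationError μ Ω g F D v R)
            * MovingObserver.fullObservation μ V
          ≤ MovingObserver.movingObservation μ V (fun t => f t • Ω) := by
    intro v R
    by_cases h : D / (b - a) < v ∧ 1 ≤ R ∧ R * D < v * (b - a)
    · obtain ⟨hv, hR, hRD⟩ := h
      obtain ⟨f, hf⟩ := MovingObserver.exists_path_realizing (F := F) _hΩ _hab _hdesign _hγ _hD0 _hD
        ((div_nonneg _hD0 hba.le).trans_lt hv) hR hRD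
      exact ⟨f, fun _ _ _ => hf⟩
    · exact ⟨fun _ => 1, fun h1 h2 h3 => (h ⟨h1, h2, h3⟩).elim⟩
  choose path hpath using hex
  obtain ⟨ρ, hlim, hρ⟩ := MovingObserver.exists_turns _hab μ Ω g F D
  -- The function `ε` is the realization error evaluated at `ρ v` turns.
  exact ⟨path, fun v hv R hR hRD => hpath v R hv hR hRD, _, ρ, hlim, fun v hv =>
    ⟨(hρ v hv).1, (hρ v hv).2, (hpath v (ρ v) hv (hρ v hv).1 (hρ v hv).2).2.2⟩⟩
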